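/- Write $(x)_k=x(x+1)\cdots(x+k-1)$ for $k\in\{0,1,2,\ldots\}$ and $(x)_{-1}=1/(x-1)$; for a vector $\mathbf{x}=(x_1,\ldots,x_p)$ put $(\mathbf{x})_k=\prod_i(x_i)_k$. Let $$F\!\left(\begin{matrix}\mathbf{a}\\ \mathbf{b}\end{matrix}\right)=\sum_{k\ge 0}\frac{(\mathbf{a})_k}{(\mathbf{b})_k\,k!}$$ be the generalized hypergeometric series at unit argument. If $-N$, $N\in\{0,1,2,\dots\}$, is among the upper parameters, the sum is over $0\le k\le N$ only. A terminating series with one more upper than lower parameters is called Saalschützian if the sum of its lower parameters minus the sum of its upper parameters equals $1$. Let $r,n\ge 0$ be integers, $\mathbf{f}=(f_1,\ldots,f_r)\in\mathbb{C}^r$, let $\mathbf{m}=(m_1,\ldots,m_r)$ be a vector of non-negative integers, $m=m_1+\cdots+m_r$, and let $a,b,c,d,e,g,h\in\mathbb{C}$. Put $\lambda=c-a-b-m$ and suppose that $(1+a+b-c)_m\ne0$, $(c-a-m)_m\ne0$, $(c-b-m)_m\ne0$ and $$g+e+n-d+\lambda=2 .$$ Let $\hat{\boldsymbol\zeta}$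 be the vector of roots (with multiplicity) of the polynomial in $t$ $$\hat Q_m(t)=\sum_{k=0}^{m}\frac{(a)_k(b)_k(t)_k}{(c-a-m)_k(c-b-m)_k\,k!}\,F\!\left(\begin{matrix}-k,\mathbf{f}+\mathbf{m}\\ \mathbf{f}\end{matrix}\right)F\!\left(\begin{matrix}-m+k,\;t+k,\;c-a-b-m\\ c-a-m+k,\;c-b-m+k\end{matrix}\right),$$ and let $$\mu=\frac{nd(h+\lambda)+h(g+\lambda-1)(e+\lambda-1)}{\lambda(h-g+1)-(g+n-1)(g-d-1)},$$ $$\Omega=\frac{(g+\lambda)_{n-1}(e+\lambda)_{n-1}}{h\,(g)_n(e)_n}\bigl(nd(h+\lambda)+h(g+\lambda-1)(e+\lambda-1)\bigr).$$ Assume that these formulas make sense: the denominator of $\mu$ is nonzero, $\mu\ne0$, $(f_i)_m\neq0$ for all $i$, and $(x)_n\ne 0$ for every lower parameter $x$ of the two series below. Then $$F\!\left(\begin{matrix}-n,a,b,d,h+1,\mathbf{f}+\mathbf{m}\\ c,g,e,h,\mathbf{f}\end{matrix}\right)=\Omega\cdot F\!\left(\begin{matrix}-n,d,a+\lambda,b+\lambda,\mu+1,\hat{\boldsymbol\zeta}+1\\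 g+\lambda,e+\lambda,c,\mu,\hat{\boldsymbol\zeta}\end{matrix}\right).$$ Moreover, the series on the left-hand side is Saalschützian, and so is the one on the right-hand side provided that $\hat Q_m$ has exact degree $m$, i.e. $\hat{\boldsymbol\zeta}$ has $m$ components. -/

import Mathlib

open scoped Polynomial

noncomputable section

/-- The Pochhammer symbol `(a)_k = a (a+1) ⋯ (a+k-1)` for a natural number `k`. -/
def poch (a : ℂ) (k : ℕ) : ℂ := (ascPochhammer ℂ k).eval a

/-- The Pochhammer symbol `(a)_k = Γ(a+k)/Γ(a)` for an integer index `k`; for `k < 0` this is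
`(a)_{-j} = 1 / ((a-j)(a-j+1)⋯(a-1)) = 1 / (a-j)_j`. -/
def pochInt (a : ℂ) : ℤ → ℂ
  | Int.ofNat k => poch a k
  | Int.negSucc k => 1 / poch (a - ((k + 1 : ℕ) : ℂ)) (k + 1)

/-- `(A)_k = ∏ (a_i)_k` for a parameter vector `A = (a_1, …, a_p)`
(a multiset, as the order of the parameters is irrelevant). -/
def pochVec (A : Multiset ℂ) (k : ℕ) : ℂ := (A.map fun a => poch a k).prod

/-- The generalized hypergeometric series `F(A; B | x) = ∑_k (A)_k / ((B)_k k!) x^k`. When some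
upper parameter is `-n` with `n : ℕ`, all terms with `k > n` vanish and the sum is finite. -/
def hypF (A B : Multiset ℂ) (x : ℂ) : ℂ :=
  ∑' k : ℕ, pochVec A k / (pochVec B k * (k.factorial : ℂ)) * x ^ k

/-- The parametric excess: sum of the lower parameters minus sum of the upper ones. -/
def parametricExcess (A B : Multiset ℂ) : ℂ := B.sum - A.sum

/-- The series `F(A; B | 1)` is Saalschützian: it is a terminating `_{p+1}F_p` with parametric
excess equal to one. -/
def IsSaalschutzian (A B : Multiset ℂ) : Prop :=
  Multiset.card A = Multiset.card B + 1 ∧ (∃ n : ℕ, -(n : ℂ) ∈ A) ∧ parametricExcess A B = 1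

/-- The vector `f` as a multiset of parameters. -/
def vecParams {r : ℕ} (f : Fin r → ℂ) : Multiset ℂ := Finset.univ.val.map f

/-- The vector `f + m = (f_1 + m_1, …, f_r + m_r)` as a multiset of parameters. -/
def shiftedParams {r : ℕ} (f : Fin r → ℂ) (m : Fin r → ℕ) : Multiset ℂ :=
  Finset.univ.val.map fun i => f i + (m i : ℂ)

/-- The characteristic polynomial `Q̂_m(a, b, c, f, m; t)`, where `m = m_1 + ⋯ + m_r`, as a
polynomial in `t`. The inner sum over `j` is the terminating series
`₃F₂(-m+k, t+k, c-a-b-m; c-a-m+k, c-b-m+k | 1)`; see `eval_Qhat`. -/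
def Qhat {r : ℕ} (a b c : ℂ) (f : Fin r → ℂ) (m : Fin r → ℕ) : ℂ[X] :=
  let M : ℕ := ∑ i, m i
  ∑ k ∈ Finset.range (M + 1),
    Polynomial.C (hypF (-(k : ℂ) ::ₘ shiftedParams f m) (vecParams f) 1 * poch a k * poch b k /
        (poch (c - a - M) k * poch (c - b - M) k * (k.factorial : ℂ))) *
      ascPochhammer ℂ k *
      ∑ j ∈ Finset.range (M - k + 1),
        Polynomial.C (poch (-(M : ℂ) + k) j * poch (c - a - b - M) j /
            (poch (c - a - M + k) j * poch (c - b - M + k) j * (j.factorial : ℂ))) *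
          (ascPochhammer ℂ j).comp (Polynomial.X + Polynomial.C (k : ℂ))

/-- `(-N)_k = 0` for `k > N`. -/
theorem poch_neg_nat {N k : ℕ} (h : N < k) : poch (-(N : ℂ)) k = 0 := by
  induction k with
  | zero => omega
  | succ k ih =>
    unfold poch at ih ⊢
    rw [ascPochhammer_succ_eval]
    rcases Nat.lt_succ_iff_lt_or_eq.mp h with h' | h'
    · rw [ih h', zero_mul]
    · subst h'; simp

/-- The values of `Qhat` are given by the formula in terms of hypergeometric series. -/
theorem eval_Qhat {r : ℕ} (a b c t : ℂ) (f : Fin r → ℂ) (m : Fin r → ℕ) :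
    (Qhat a b c f m).eval t =
      ∑ k ∈ Finset.range ((∑ i, m i) + 1),
        hypF (-(k : ℂ) ::ₘ shiftedParams f m) (vecParams f) 1 * poch a k * poch b k * poch t k /
          (poch (c - a - (∑ i, m i : ℕ)) k * poch (c - b - (∑ i, m i : ℕ)) k *
            (k.factorial : ℂ)) *
        hypF {-((∑ i, m i : ℕ) : ℂ) + k, t + k, c - a - b - (∑ i, m i : ℕ)}
          {c - a - (∑ i, m i : ℕ) + k, c - b - (∑ i, m i : ℕ) + k} 1 := by
  unfold Qhat
  generalize (∑ i, m i : ℕ) = M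
  simp only [Polynomial.eval_finsetSum, Polynomial.eval_mul, Polynomial.eval_C,
    Polynomial.eval_comp, Polynomial.eval_add, Polynomial.eval_X]
  refine Finset.sum_congr rfl fun k hk => ?_
  have hkM : k ≤ M := Nat.lt_succ_iff.mp (Finset.mem_range.mp hk)
  have key : hypF {-(M : ℂ) + k, t + k, c - a - b - M} {c - a - M + k, c - b - M + k} 1 =
      ∑ j ∈ Finset.range (M - k + 1),
        poch (-(M : ℂ) + k) j * poch (c - a - b - M) j /
            (poch (c - a - M + k) j * poch (c - b - M + k) j * (j.factorial : ℂ)) *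
          (ascPochhammer ℂ j).eval (t + k) := by
    unfold hypF
    rw [tsum_eq_sum (s := Finset.range (M - k + 1))]
    · refine Finset.sum_congr rfl fun j _ => ?_
      simp only [pochVec, Multiset.insert_eq_cons, Multiset.map_cons, Multiset.prod_cons,
        Multiset.map_singleton, Multiset.prod_singleton, one_pow, mul_one]
      have : (ascPochhammer ℂ j).eval (t + k) = poch (t + k) j := rfl
      rw [this]
      ring
    · intro j hj
      have hj' : M - k < j := by
        rw [Finset.mem_range] at hj; omega
      have h0 : poch (-(M : ℂ) + k) j = 0 := by
        have h1 := poch_neg_nat hj'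
        rw [Nat.cast_sub hkM] at h1
        rw [← h1]; congr 1; ring
      simp [pochVec, h0]
  rw [key]
  have ht : (ascPochhammer ℂ k).eval t = poch t k := rfl
  rw [ht]
  ring

/-- The common numerator `n d (h + λ) + h (g + λ - 1) (e + λ - 1)` of `Ω` and `μ`. -/
def muNum (n : ℕ) (d e g h lam : ℂ) : ℂ :=
  n * d * (h + lam) + h * (g + lam - 1) * (e + lam - 1)

/-- The denominator `λ (h - g + 1) - (g + n - 1) (g - d - 1)` of `μ`. -/
def muDen (n : ℕ) (d g h lam : ℂ) : ℂ :=
  lam * (h - g + 1) - (g + n - 1) * (g - d - 1)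

/-- The parameter `μ`. -/
def muParam (n : ℕ) (d e g h lam : ℂ) : ℂ := muNum n d e g h lam / muDen n d g h lam

/-- The factor `Ω`. -/
def OmegaFactor (n : ℕ) (d e g h lam : ℂ) : ℂ :=
  pochInt (g + lam) ((n : ℤ) - 1) * pochInt (e + lam) ((n : ℤ) - 1) /
    (h * poch g n * poch e n) * muNum n d e g h lam

/-- The upper parameters `-n, a, b, d, h+1, f+m` of the left-hand side. -/
def lhsUpper {r : ℕ} (n : ℕ) (a b d h : ℂ) (f : Fin r → ℂ) (m : Fin r → ℕ) : Multiset ℂ :=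
  {-(n : ℂ), a, b, d, h + 1} + shiftedParams f m

/-- The lower parameters `c, g, e, h, f` of the left-hand side. -/
def lhsLower {r : ℕ} (c g e h : ℂ) (f : Fin r → ℂ) : Multiset ℂ :=
  {c, g, e, h} + vecParams f

/-- The upper parameters `-n, d, a+λ, b+λ, μ+1, ζ+1` of the right-hand side. -/
def rhsUpper (n : ℕ) (a b d lam mu : ℂ) (zeta : Multiset ℂ) : Multiset ℂ :=
  {-(n : ℂ), d, a + lam, b + lam, mu + 1} + zeta.map fun z => z + 1

/-- The lower parameters `g+λ, e+λ, c, μ, ζ` of the right-hand side. -/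
def rhsLower (c g e lam mu : ℂ) (zeta : Multiset ℂ) : Multiset ℂ :=
  {g + lam, e + lam, c, mu} + zeta

end

open Finset

/-! ### Pochhammer symbols -/

/-! Let A_i be (a)_i (b)_i / ((c)_i i!) times the ratio (f+m)_i / (f)_i. Read coefficientwise, the
Miller-Paris extension of Euler's transformation says that Σ_{i+j=N} (λ)_j/j! · A_i equals (a+λ)_N
(b+λ)_N / ((c)_N N!) · Q̂(-N) (`miller_paris_coeff`). Since Q̂(0) = 1, the factor Q̂(-N) is what the
pair ζ+1 over ζ contributes (`pochVec_roots_add_one`). Substitute this into the right-hand series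
and collect the coefficient of A_i: it is a balanced terminating ₄F₃(1) with a pair w+1 over w,
hence summable, and Ω and μ are such that the result is the coefficient of A_i on the left
(`omega_mul_sum_shiftCoeff`).

For the Miller-Paris step, (f+m)_i / (f)_i is a polynomial in i. Newton's expansion reduces it to
the functions (-i)_k, with the hypergeometric values occurring in Q̂ as coefficients. For a single k
the claim is Sheppard's ₃F₂ transformation. All the summations rest on Chu-Vandermonde, kept in
product form over antidiagonals so that no parameter has to be nonzero. -/

theorem poch_zero (a : ℂ) : poch a 0 = 1 := by simp [poch]

theorem poch_one (a : ℂ) : poch a 1 = a := by simp [poch]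

theorem poch_succ (a : ℂ) (k : ℕ) : poch a (k + 1) = poch a k * (a + k) :=
  ascPochhammer_succ_eval k a

theorem poch_add (a : ℂ) (k l : ℕ) : poch a (k + l) = poch a k * poch (a + k) l := by
  induction l with
  | zero => simp [poch_zero]
  | succ l ih =>
    rw [← add_assoc, poch_succ, ih, poch_succ]
    push_cast
    ring

theorem poch_succ_left (a : ℂ) (k : ℕ) : poch a (k + 1) = a * poch (a + 1) k := by
  rw [add_comm, poch_add, poch_one, Nat.cast_one]

theorem poch_ne_zero_of_le {a : ℂ} {k n : ℕ} (hk : k ≤ n) (h : poch a n ≠ 0) : poch a k ≠ 0 := by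
  obtain ⟨l, rfl⟩ := Nat.exists_eq_add_of_le hk
  rw [poch_add] at h
  exact left_ne_zero_of_mul h

/-- The reflection `(1 - x - q)_q = (-1)^q (x)_q`. -/
theorem poch_reflect (x : ℂ) (q : ℕ) : poch (1 - x - q) q = (-1) ^ q * poch x q := by
  induction q with
  | zero => simp [poch_zero]
  | succ q ih =>
    rw [poch_succ_left, poch_succ, pow_succ,
      show 1 - x - ((q + 1 : ℕ) : ℂ) + 1 = 1 - x - q by push_cast; ring, ih]
    push_cast
    ring

theorem poch_neg_add (n l : ℕ) :
    poch (-((n + l : ℕ) : ℂ)) n * (l.factorial : ℂ) = (-1) ^ n * ((n + l).factorial : ℂ) := by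
  induction n generalizing l with
  | zero => simp [poch_zero]
  | succ n ih =>
    have h := ih (l + 1)
    rw [show n + 1 + l = n + (l + 1) by ring, poch_succ, pow_succ]
    rw [Nat.factorial_succ] at h
    push_cast at h ⊢
    linear_combination (-1 : ℂ) * h

theorem poch_neg_nat_eq (n l : ℕ) :
    poch (-((n + l : ℕ) : ℂ)) n = (-1) ^ n * ((n + l).factorial : ℂ) / (l.factorial : ℂ) := by
  rw [← poch_neg_add, mul_div_cancel_right₀ _ (Nat.cast_ne_zero.mpr l.factorial_ne_zero)]

/-! ### Sums over antidiagonals -/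

theorem choose_div_factorial {n : ℕ} {p : ℕ × ℕ} (hp : p ∈ antidiagonal n) :
    (n.choose p.1 : ℂ) / (n.factorial : ℂ) = 1 / ((p.1.factorial : ℂ) * (p.2.factorial : ℂ)) := by
  rw [HasAntidiagonal.mem_antidiagonal] at hp
  have h := Nat.add_choose_mul_factorial_mul_factorial p.2 p.1
  rw [add_comm p.2, hp] at h
  have h' : (n.choose p.1 : ℂ) * p.2.factorial * p.1.factorial = n.factorial := by exact_mod_cast h
  have h1 : (p.1.factorial : ℂ) ≠ 0 := Nat.cast_ne_zero.mpr (Nat.factorial_ne_zero _)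
  have h2 : (p.2.factorial : ℂ) ≠ 0 := Nat.cast_ne_zero.mpr (Nat.factorial_ne_zero _)
  have h3 : (n.factorial : ℂ) ≠ 0 := Nat.cast_ne_zero.mpr (Nat.factorial_ne_zero _)
  rw [div_eq_div_iff h3 (mul_ne_zero h1 h2)]
  linear_combination h'

/-- Both sides run over all triples with i + j + k = n; this performs every interchange of summation
over antidiagonals below. -/
theorem sum_antidiagonal_assoc (n : ℕ) (F : ℕ → ℕ → ℕ → ℂ) :
    ∑ p ∈ antidiagonal n, ∑ s ∈ antidiagonal p.1, F s.1 s.2 p.2 =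
      ∑ p ∈ antidiagonal n, ∑ s ∈ antidiagonal p.2, F p.1 s.1 s.2 := by
  rw [sum_sigma', sum_sigma']
  refine sum_nbij' (fun x => ⟨(x.2.1, x.2.2 + x.1.2), (x.2.2, x.1.2)⟩)
    (fun x => ⟨(x.1.1 + x.2.1, x.2.2), (x.1.1, x.2.1)⟩) ?_ ?_ ?_ ?_ ?_
  · rintro ⟨⟨i, j⟩, ⟨k, l⟩⟩ h
    simp only [mem_sigma, HasAntidiagonal.mem_antidiagonal] at h ⊢
    exact ⟨by omega, trivial⟩
  · rintro ⟨⟨i, j⟩, ⟨k, l⟩⟩ h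
    simp only [mem_sigma, HasAntidiagonal.mem_antidiagonal] at h ⊢
    exact ⟨by omega, trivial⟩
  · rintro ⟨⟨i, j⟩, ⟨k, l⟩⟩ h
    simp only [mem_sigma, HasAntidiagonal.mem_antidiagonal] at h
    obtain ⟨-, rfl⟩ := h
    rfl
  · rintro ⟨⟨i, j⟩, ⟨k, l⟩⟩ h
    simp only [mem_sigma, HasAntidiagonal.mem_antidiagonal] at h
    obtain ⟨-, rfl⟩ := h
    rfl
  · rintro ⟨⟨i, j⟩, ⟨k, l⟩⟩ h
    rfl

/-- The Pascal recursion for binomially weighted antidiagonal sums. -/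
theorem sum_antidiagonal_choose_succ (f : ℕ → ℕ → ℂ) (n : ℕ) :
    ∑ p ∈ antidiagonal (n + 1), ((n + 1).choose p.1 : ℂ) * f p.1 p.2 =
      ∑ p ∈ antidiagonal n, (n.choose p.1 : ℂ) * f p.1 (p.2 + 1) +
        ∑ p ∈ antidiagonal n, (n.choose p.1 : ℂ) * f (p.1 + 1) p.2 := by
  rw [sum_antidiagonal_choose_succ_mul]
  congr 1
  refine sum_congr rfl fun p hp => ?_
  rw [HasAntidiagonal.mem_antidiagonal] at hp
  rw [← Nat.choose_symm_of_eq_add hp.symm]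

/-! ### Chu-Vandermonde and consequences -/

/-- The Chu-Vandermonde summation, cleared of denominators. -/
theorem chu_vandermonde (X D : ℂ) (n : ℕ) :
    ∑ p ∈ antidiagonal n, (n.choose p.1 : ℂ) * ((-1) ^ p.1 * poch X p.1 * poch (D + p.1) p.2) =
      poch (D - X) n := by
  induction n generalizing X D with
  | zero => simp [poch_zero]
  | succ n ih =>
    rw [sum_antidiagonal_choose_succ fun i j => (-1) ^ i * poch X i * poch (D + i) j]
    have h1 : ∑ p ∈ antidiagonal n,
        (n.choose p.1 : ℂ) * ((-1) ^ p.1 * poch X p.1 * poch (D + p.1) (p.2 + 1)) =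
          (D + n) * poch (D - X) n := by
      rw [← ih X D, mul_sum]
      refine sum_congr rfl fun p hp => ?_
      rw [HasAntidiagonal.mem_antidiagonal] at hp
      rw [poch_succ, ← hp]
      push_cast
      ring
    have h2 : ∑ p ∈ antidiagonal n, (n.choose p.1 : ℂ) *
        ((-1) ^ (p.1 + 1) * poch X (p.1 + 1) * poch (D + (p.1 + 1 : ℕ)) p.2) =
          -X * poch (D - X) n := by
      -- Raising X and D together keeps D - X, so both Pascal halves are multiples of the same
      -- product.
      rw [show D - X = (D + 1) - (X + 1) by ring, ← ih (X + 1) (D + 1), mul_sum]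
      refine sum_congr rfl fun p _ => ?_
      rw [poch_succ_left, pow_succ,
        show D + ((p.1 + 1 : ℕ) : ℂ) = D + 1 + p.1 by push_cast; ring]
      ring
    rw [h1, h2, poch_succ]
    ring

theorem chu_vandermonde_div (X D : ℂ) (n : ℕ) :
    ∑ p ∈ antidiagonal n, (-1) ^ p.1 * poch X p.1 * poch (D + p.1) p.2 /
        ((p.1.factorial : ℂ) * (p.2.factorial : ℂ)) = poch (D - X) n / n.factorial := by
  rw [← chu_vandermonde, sum_div]
  refine sum_congr rfl fun p hp => ?_
  rw [div_eq_mul_one_div, ← choose_div_factorial hp]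
  ring

/-- A transformation of terminating `₃F₂(1)` series, cleared of denominators. -/
theorem three_two_transformation (A B D E : ℂ) (n : ℕ) :
    ∑ p ∈ antidiagonal n, (-1) ^ p.1 * poch A p.1 * poch B p.1 * poch (D + p.1) p.2 *
        poch (E + p.1) p.2 / ((p.1.factorial : ℂ) * (p.2.factorial : ℂ)) =
      ∑ p ∈ antidiagonal n, poch (D - A) p.1 * poch B p.1 * poch (D + p.1) p.2 *
        poch (E - B) p.2 / ((p.1.factorial : ℂ) * (p.2.factorial : ℂ)) := by
  have hL : ∀ p ∈ antidiagonal n,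
      (-1) ^ p.1 * poch A p.1 * poch B p.1 * poch (D + p.1) p.2 *
        poch (E + p.1) p.2 / ((p.1.factorial : ℂ) * (p.2.factorial : ℂ)) =
      ∑ s ∈ antidiagonal p.1, (-1) ^ s.2 * poch (D - A) s.1 * poch B (s.1 + s.2) *
        poch (D + s.1) (s.2 + p.2) * poch (E + (s.1 + s.2 : ℕ)) p.2 /
          ((s.1.factorial : ℂ) * (s.2.factorial : ℂ) * (p.2.factorial : ℂ)) := by
    intro p _
    -- Chu-Vandermonde, used backwards, expands (A)_p; after reassociation the inner sum is again of
    -- Chu-Vandermonde type.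
    have h := chu_vandermonde_div (D - A) D p.1
    rw [sub_sub_cancel] at h
    calc _ = (poch A p.1 / p.1.factorial) * ((-1) ^ p.1 * poch B p.1 * poch (D + p.1) p.2 *
          poch (E + p.1) p.2 / p.2.factorial) := by field_simp
      _ = _ := by
        rw [← h, sum_mul]
        refine sum_congr rfl fun s hs => ?_
        rw [HasAntidiagonal.mem_antidiagonal] at hs
        rw [← hs, poch_add (D + s.1) s.2 p.2, pow_add,
          show D + s.1 + s.2 = D + (s.1 + s.2 : ℕ) by push_cast; ring]
        have h2 : ((-1 : ℂ) ^ s.1) * (-1) ^ s.1 = 1 := by rw [← mul_pow]; simp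
        linear_combination (poch (D - A) s.1 * poch (D + s.1) s.2 * (-1) ^ s.2 *
          poch B (s.1 + s.2) * poch (D + (s.1 + s.2 : ℕ)) p.2 *
            poch (E + (s.1 + s.2 : ℕ)) p.2 /
              ((s.1.factorial : ℂ) * (s.2.factorial : ℂ) * (p.2.factorial : ℂ))) * h2
  rw [sum_congr rfl hL, sum_antidiagonal_assoc n fun i j k =>
    (-1) ^ j * poch (D - A) i * poch B (i + j) *
        poch (D + i) (j + k) * poch (E + (i + j : ℕ)) k /
          ((i.factorial : ℂ) * (j.factorial : ℂ) * (k.factorial : ℂ))]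
  refine sum_congr rfl fun p _ => ?_
  have h := chu_vandermonde_div (B + p.1) (E + p.1) p.2
  rw [add_sub_add_right_eq_sub] at h
  calc _ = (poch (D - A) p.1 * poch B p.1 * poch (D + p.1) p.2 / p.1.factorial) *
        (poch (E - B) p.2 / p.2.factorial) := by
        rw [← h, mul_sum]
        refine sum_congr rfl fun s hs => ?_
        rw [HasAntidiagonal.mem_antidiagonal] at hs
        rw [hs, poch_add B, show E + ((p.1 + s.1 : ℕ) : ℂ) = E + p.1 + s.1 by push_cast; ring]
        field_simp
    _ = _ := by field_simp

/-- Sheppard's transformation between two terminating `₃F₂(1)` series, cleared of denominators. -/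
theorem sheppard_transformation (a b c lam x : ℂ) (n : ℕ) (hc : c = a + b + x + lam) :
    ∑ p ∈ antidiagonal n, (-1) ^ p.1 * poch (-x) p.1 * poch lam p.1 * poch (a + lam + p.1) p.2 *
        poch (b + lam + p.1) p.2 / ((p.1.factorial : ℂ) * (p.2.factorial : ℂ)) =
      ∑ p ∈ antidiagonal n, poch lam p.2 * poch a p.1 * poch b p.1 * poch (c + p.1) p.2 /
        ((p.1.factorial : ℂ) * (p.2.factorial : ℂ)) := by
  have h1 := three_two_transformation (-x) lam (a + lam) (b + lam) n
  -- With lower parameter 1 - b - n, reflection makes the left side here (-1)^n times the right side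
  -- of `h1`, so the two transformations compose. The result has its indices reversed, hence the
  -- later swap.
  have h2 := three_two_transformation (a + lam + x) lam (1 - b - n) (a + lam) n
  have h3 : ∀ p ∈ antidiagonal n, poch (1 - b - n + p.1) p.2 = (-1) ^ p.2 * poch b p.2 := by
    intro p hp
    rw [HasAntidiagonal.mem_antidiagonal] at hp
    rw [← poch_reflect, ← hp]
    congr 1
    push_cast
    ring
  have h4 : ∀ p ∈ antidiagonal n, poch (1 - b - n - (a + lam + x)) p.1 =
      (-1) ^ p.1 * poch (c + p.2) p.1 := by
    intro p hp
    rw [HasAntidiagonal.mem_antidiagonal] at hp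
    rw [← poch_reflect, ← hp, hc]
    congr 1
    push_cast
    ring
  have hs : ∀ p ∈ antidiagonal n, ((-1 : ℂ) ^ n) = (-1) ^ p.1 * (-1) ^ p.2 := by
    intro p hp
    rw [HasAntidiagonal.mem_antidiagonal] at hp
    rw [← hp, pow_add]
  have hn : ((-1 : ℂ) ^ n) ≠ 0 := pow_ne_zero _ (by norm_num)
  rw [h1]
  symm
  rw [← Nat.sum_antidiagonal_swap]
  symm
  apply mul_left_cancel₀ hn
  rw [mul_sum, mul_sum]
  refine Eq.trans (sum_congr rfl fun p hp => ?_) (h2.trans (sum_congr rfl fun p hp => ?_))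
  · rw [h3 p hp, hs p hp]
    simp only [sub_neg_eq_add, add_sub_cancel_right]
    ring
  · rw [h3 p hp, h4 p hp, hs p hp]
    simp only [Prod.fst_swap, Prod.snd_swap, add_sub_cancel_right]
    ring

/-- The Pfaff-Saalschütz summation, cleared of denominators. -/
theorem pfaff_saalschutz (d lam G E : ℂ) (n : ℕ) (h : G + E + n - d - lam = 1) :
    ∑ p ∈ antidiagonal n, (n.choose p.1 : ℂ) * ((-1) ^ p.1 * poch d p.1 * poch lam p.1 *
        poch (G + p.1) p.2 * poch (E + p.1) p.2) = poch (G - lam) n * poch (E - lam) n := by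
  have hn : (n.factorial : ℂ) ≠ 0 := Nat.cast_ne_zero.mpr n.factorial_ne_zero
  have key := three_two_transformation d lam G E n
  -- The balance condition reads E - lam = 1 - (G - d) - n. Hence (G-d)_p (E-lam)_q is, up to sign,
  -- the constant (E-lam)_n, and Chu-Vandermonde sums what is left.
  have hE : poch (E - lam) n = (-1) ^ n * poch (G - d) n := by
    rw [← poch_reflect]
    congr 1
    linear_combination h
  have h1 : ∀ p ∈ antidiagonal n, poch (G - d) p.1 * poch lam p.1 * poch (G + p.1) p.2 *
        poch (E - lam) p.2 / ((p.1.factorial : ℂ) * (p.2.factorial : ℂ)) =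
      poch (E - lam) n * ((-1) ^ p.1 * poch lam p.1 * poch (G + p.1) p.2 /
        ((p.1.factorial : ℂ) * (p.2.factorial : ℂ))) := by
    intro p hp
    rw [HasAntidiagonal.mem_antidiagonal] at hp
    have h2 : poch (E - lam) p.2 = (-1) ^ p.2 * poch (G - d + p.1) p.2 := by
      rw [← poch_reflect]
      congr 1
      rw [← hp] at h
      push_cast at h
      linear_combination h
    have h3 : ((-1 : ℂ) ^ p.1) * (-1) ^ p.1 = 1 := by rw [← mul_pow]; simp
    rw [hE, h2, ← hp, poch_add (G - d), pow_add]
    linear_combination (-(poch (G - d) p.1 * poch lam p.1 * poch (G + p.1) p.2 *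
        ((-1) ^ p.2 * poch (G - d + p.1) p.2) / ((p.1.factorial : ℂ) * (p.2.factorial : ℂ)))) * h3
  rw [sum_congr rfl h1, ← mul_sum, chu_vandermonde_div] at key
  apply mul_right_cancel₀ (inv_ne_zero hn)
  rw [sum_mul, ← div_eq_mul_inv, mul_comm (poch _ _), mul_div_assoc, ← key]
  refine sum_congr rfl fun p hp => ?_
  rw [div_eq_mul_one_div _ ((_ : ℂ) * _), ← choose_div_factorial hp]
  ring

/-- The summation of a terminating `₃F₂(1)` with parametric excess `2`. -/
theorem two_balanced_sum (d lam G E : ℂ) (n : ℕ) (h : G + E + (n + 1 : ℕ) - d - lam = 2) :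
    ∑ p ∈ antidiagonal (n + 1), ((n + 1).choose p.1 : ℂ) * ((-1) ^ p.1 * poch d p.1 *
        poch lam p.1 * poch (G + p.1) p.2 * poch (E + p.1) p.2) =
      poch (G - lam) n * poch (E - lam) n * ((G + n) * (E + n) - d * lam) := by
  push_cast at h
  rw [sum_antidiagonal_choose_succ fun i j => (-1) ^ i * poch d i *
        poch lam i * poch (G + i) j * poch (E + i) j]
  -- Pascal's rule lowers the length by one, which turns excess 2 into excess 1: both halves are
  -- Saalschützian, the second with all four parameters raised by 1.
  have h1 := pfaff_saalschutz d lam G E n (by linear_combination h)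
  have h2 := pfaff_saalschutz (d + 1) (lam + 1) (G + 1) (E + 1) n (by linear_combination h)
  rw [add_sub_add_right_eq_sub, add_sub_add_right_eq_sub] at h2
  have e1 : (G + n) * (E + n) * (poch (G - lam) n * poch (E - lam) n) =
      ∑ p ∈ antidiagonal n, (n.choose p.1 : ℂ) * ((-1) ^ p.1 * poch d p.1 *
        poch lam p.1 * poch (G + p.1) (p.2 + 1) * poch (E + p.1) (p.2 + 1)) := by
    rw [← h1, mul_sum]
    refine sum_congr rfl fun p hp => ?_
    rw [HasAntidiagonal.mem_antidiagonal] at hp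
    rw [poch_succ, poch_succ, ← hp]
    push_cast
    ring
  have e2 : (-(d * lam)) * (poch (G - lam) n * poch (E - lam) n) =
      ∑ p ∈ antidiagonal n, (n.choose p.1 : ℂ) * ((-1) ^ (p.1 + 1) * poch d (p.1 + 1) *
        poch lam (p.1 + 1) * poch (G + (p.1 + 1 : ℕ)) p.2 * poch (E + (p.1 + 1 : ℕ)) p.2) := by
    rw [← h2, mul_sum]
    refine sum_congr rfl fun p hp => ?_
    rw [poch_succ_left, poch_succ_left, pow_succ,
      show G + ((p.1 + 1 : ℕ) : ℂ) = G + 1 + p.1 by push_cast; ring,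
      show E + ((p.1 + 1 : ℕ) : ℂ) = E + 1 + p.1 by push_cast; ring]
    ring
  rw [← e1, ← e2]
  ring

/-- The summation of a Saalschützian terminating `₄F₃(1)` with a parameter pair `w + 1`, `w`. -/
theorem saalschutz_with_unit_shift (d lam w G E : ℂ) (n : ℕ)
    (h : G + E + (n + 1 : ℕ) - d - lam = 2) :
    ∑ p ∈ antidiagonal (n + 1), ((n + 1).choose p.1 : ℂ) * ((-1) ^ p.1 * poch d p.1 *
        poch lam p.1 * (w + p.1) * poch (G + p.1) p.2 * poch (E + p.1) p.2) =
      poch (G - lam) n * poch (E - lam) n *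
        ((n + 1) * d * (w - lam) + w * (G - lam - 1) * (E - lam - 1)) := by
  -- Split w + p = (w - lam) + (lam + p). The second summand turns (lam)_p into lam (lam+1)_p, which
  -- lowers the excess from 2 to 1.
  have h1 := two_balanced_sum d lam G E n h
  have h2 := pfaff_saalschutz d (lam + 1) G E (n + 1) (by linear_combination h)
  rw [poch_succ_left, poch_succ_left, show G - (lam + 1) + 1 = G - lam by ring,
    show E - (lam + 1) + 1 = E - lam by ring] at h2
  push_cast at h
  have hsplit : ∑ p ∈ antidiagonal (n + 1), ((n + 1).choose p.1 : ℂ) * ((-1) ^ p.1 * poch d p.1 *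
        poch lam p.1 * (w + p.1) * poch (G + p.1) p.2 * poch (E + p.1) p.2) =
      (w - lam) * ∑ p ∈ antidiagonal (n + 1), ((n + 1).choose p.1 : ℂ) * ((-1) ^ p.1 * poch d p.1 *
        poch lam p.1 * poch (G + p.1) p.2 * poch (E + p.1) p.2) +
      lam * ∑ p ∈ antidiagonal (n + 1), ((n + 1).choose p.1 : ℂ) * ((-1) ^ p.1 * poch d p.1 *
        poch (lam + 1) p.1 * poch (G + p.1) p.2 * poch (E + p.1) p.2) := by
    rw [mul_sum, mul_sum, ← sum_add_distrib]
    refine sum_congr rfl fun p _ => ?_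
    have h3 : lam * poch (lam + 1) p.1 = poch lam p.1 * (lam + p.1) := by
      rw [← poch_succ_left, poch_succ]
    linear_combination (-(((n + 1).choose p.1 : ℂ) * ((-1) ^ p.1 * poch d p.1 *
      poch (G + p.1) p.2 * poch (E + p.1) p.2))) * h3
  rw [hsplit, h1, h2]
  linear_combination (poch (G - lam) n * poch (E - lam) n * (w - lam) * (n + 1 + lam)) * h

/-! ### Newton's expansion -/

theorem poch_neg_div_factorial (j k : ℕ) :
    poch (-(j : ℂ)) k / (k.factorial : ℂ) = (-1) ^ k * (j.choose k : ℂ) := by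
  rcases lt_or_ge j k with h | h
  · rw [poch_neg_nat h, Nat.choose_eq_zero_of_lt h]
    simp
  · obtain ⟨l, rfl⟩ := Nat.exists_eq_add_of_le h
    have h1 : (k.factorial : ℂ) ≠ 0 := Nat.cast_ne_zero.mpr (Nat.factorial_ne_zero _)
    have h2 : (l.factorial : ℂ) ≠ 0 := Nat.cast_ne_zero.mpr (Nat.factorial_ne_zero _)
    have h3 : (((l + k).choose k : ℕ) : ℂ) * l.factorial * k.factorial = (l + k).factorial := by
      exact_mod_cast Nat.add_choose_mul_factorial_mul_factorial l k
    rw [poch_neg_nat_eq, add_comm k l, ← h3]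
    field_simp

/-- Newton's expansion of a polynomial, in terms of Pochhammer symbols. -/
theorem newton_expansion (Q : ℂ[X]) {M : ℕ} (hQ : Q.natDegree ≤ M) (j : ℕ) :
    Q.eval (j : ℂ) = ∑ k ∈ range (M + 1), poch (-(j : ℂ)) k / (k.factorial : ℂ) *
      ∑ i ∈ range (k + 1), poch (-(k : ℂ)) i / (i.factorial : ℂ) * Q.eval (i : ℂ) := by
  have hterm : ∀ k : ℕ, poch (-(j : ℂ)) k / (k.factorial : ℂ) *
      ∑ i ∈ range (k + 1), poch (-(k : ℂ)) i / (i.factorial : ℂ) * Q.eval (i : ℂ) =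
        (j.choose k : ℂ) * (fwdDiff (1 : ℂ))^[k] Q.eval 0 := by
    intro k
    rw [fwdDiff_iter_eq_sum_shift, poch_neg_div_factorial, mul_comm ((-1 : ℂ) ^ k), mul_assoc,
      mul_sum]
    congr 1
    refine sum_congr rfl fun i hi => ?_
    obtain ⟨l, rfl⟩ := Nat.exists_eq_add_of_le (Nat.lt_succ_iff.mp (mem_range.mp hi))
    have h : ((-1 : ℂ) ^ i) * (-1) ^ i = 1 := by rw [← mul_pow]; simp
    rw [poch_neg_div_factorial, Nat.add_sub_cancel_left, pow_add, zsmul_eq_mul]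
    simp only [nsmul_eq_mul, mul_one, zero_add]
    push_cast
    linear_combination ((-1 : ℂ) ^ l * ((i + l).choose i : ℂ) * Q.eval (i : ℂ)) * h
  have h0 := shift_eq_sum_fwdDiff_iter (1 : ℂ) Q.eval j 0
  rw [nsmul_eq_mul, mul_one, zero_add] at h0
  rw [h0, sum_congr rfl fun k _ => hterm k]
  simp only [nsmul_eq_mul]
  -- Both sums extend to a common range: the binomials vanish beyond j, the differences beyond the
  -- degree.
  have e1 : ∑ k ∈ range (j + 1), (j.choose k : ℂ) * (fwdDiff (1 : ℂ))^[k] Q.eval 0 =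
      ∑ k ∈ range (j + M + 1), (j.choose k : ℂ) * (fwdDiff (1 : ℂ))^[k] Q.eval 0 := by
    refine sum_subset (range_subset_range.mpr (by omega)) fun k _ hk => ?_
    rw [mem_range, not_lt] at hk
    rw [Nat.choose_eq_zero_of_lt hk, Nat.cast_zero, zero_mul]
  have e2 : ∑ k ∈ range (M + 1), (j.choose k : ℂ) * (fwdDiff (1 : ℂ))^[k] Q.eval 0 =
      ∑ k ∈ range (j + M + 1), (j.choose k : ℂ) * (fwdDiff (1 : ℂ))^[k] Q.eval 0 := by
    refine sum_subset (range_subset_range.mpr (by omega)) fun k _ hk => ?_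
    rw [mem_range, not_lt] at hk
    rw [Polynomial.fwdDiff_iter_eq_zero_of_degree_lt (by omega : Q.natDegree < k), Pi.zero_apply,
      mul_zero]
  rw [e1, e2]

/-! ### The second Miller-Paris transformation, coefficientwise -/

theorem sum_antidiagonal_shift (k n : ℕ) (f : ℕ × ℕ → ℂ) (hf : ∀ p : ℕ × ℕ, p.1 < k → f p = 0) :
    ∑ p ∈ antidiagonal (k + n), f p = ∑ p ∈ antidiagonal n, f (k + p.1, p.2) := by
  induction k generalizing f with
  | zero => simp
  | succ k ih =>
    rw [show k + 1 + n = k + n + 1 by ring, Nat.sum_antidiagonal_succ, hf (0, _) (Nat.succ_pos k),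
      zero_add, ih (fun p => f (p.1 + 1, p.2)) fun p hp => hf _ (Nat.succ_lt_succ hp)]
    refine sum_congr rfl fun p _ => ?_
    rw [show k + 1 + p.1 = k + p.1 + 1 by ring]

/-- The coefficient form of the second Miller-Paris transformation, for one term of the Newton
expansion of the numerator polynomial. -/
theorem miller_paris_term {a b c lam : ℂ} {M N k : ℕ} (hk : k ≤ M) (hlam : lam = c - a - b - M)
    (hc : poch c N ≠ 0) (h2 : poch (c - a - M) M ≠ 0) (h3 : poch (c - b - M) M ≠ 0) :
    ∑ p ∈ antidiagonal N, poch lam p.2 / (p.2.factorial : ℂ) *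
        (poch a p.1 * poch b p.1 / (poch c p.1 * (p.1.factorial : ℂ))) * poch (-(p.1 : ℂ)) k =
      poch (c - b - M) N * poch (c - a - M) N / (poch c N * (N.factorial : ℂ)) *
        (poch a k * poch b k * poch (-(N : ℂ)) k / (poch (c - a - M) k * poch (c - b - M) k)) *
        ∑ l ∈ range (M - k + 1), poch (-(M : ℂ) + k) l * poch lam l /
          (poch (c - a - M + k) l * poch (c - b - M + k) l * (l.factorial : ℂ)) *
            poch (-(N : ℂ) + k) l := by
  rcases lt_or_ge N k with h | h
  · rw [poch_neg_nat h, mul_zero, zero_div, mul_zero, zero_mul]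
    refine sum_eq_zero fun p hp => ?_
    rw [HasAntidiagonal.mem_antidiagonal] at hp
    rw [poch_neg_nat (by omega), mul_zero]
  obtain ⟨n, rfl⟩ := Nat.exists_eq_add_of_le h
  obtain ⟨x, rfl⟩ := Nat.exists_eq_add_of_le hk
  set A : ℂ := c - a - (k + x : ℕ) with hA
  set B : ℂ := c - b - (k + x : ℕ) with hB
  rw [sum_antidiagonal_shift k n _ fun p hp => by rw [poch_neg_nat hp, mul_zero],
    Nat.add_sub_cancel_left]
  have hx : -((k + x : ℕ) : ℂ) + k = -(x : ℂ) := by push_cast; ring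
  have hn : -((k + n : ℕ) : ℂ) + k = -(n : ℂ) := by push_cast; ring
  rw [hx, hn]
  -- The factor (-i)_k kills i < k; shifting i by k leaves a Sheppard sum with x = M - k.
  have hS := sheppard_transformation (a + k) (b + k) (c + k) lam x n
    (by rw [hlam]; push_cast; ring)
  rw [show a + k + lam = B + k by rw [hlam, hB]; ring,
    show b + k + lam = A + k by rw [hlam, hA]; ring] at hS
  have hrange : ∑ l ∈ range (x + 1), poch (-(x : ℂ)) l * poch lam l /
          (poch (A + k) l * poch (B + k) l * (l.factorial : ℂ)) * poch (-(n : ℂ)) l =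
      ∑ p ∈ antidiagonal n, poch (-(x : ℂ)) p.1 * poch lam p.1 /
          (poch (A + k) p.1 * poch (B + k) p.1 * (p.1.factorial : ℂ)) * poch (-(n : ℂ)) p.1 := by
    rw [Nat.sum_antidiagonal_eq_sum_range_succ_mk]
    have e1 : range (x + 1) ⊆ range (x + n + 1) := range_subset_range.mpr (by omega)
    have e2 : range n.succ ⊆ range (x + n + 1) := range_subset_range.mpr (by omega)
    rw [sum_subset e1, sum_subset e2]
    · intro l _ hl
      rw [mem_range, not_lt] at hl
      rw [poch_neg_nat (N := n) hl, mul_zero]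
    · intro l _ hl
      rw [mem_range, not_lt] at hl
      rw [poch_neg_nat (N := x) hl]
      simp
  rw [hrange]
  have hL : ∀ p ∈ antidiagonal n, poch lam p.2 / (p.2.factorial : ℂ) *
      (poch a (k + p.1) * poch b (k + p.1) / (poch c (k + p.1) * ((k + p.1).factorial : ℂ))) *
        poch (-((k + p.1 : ℕ) : ℂ)) k =
      (-1) ^ k * poch a k * poch b k / poch c (k + n) * (poch lam p.2 * poch (a + k) p.1 *
        poch (b + k) p.1 * poch (c + k + p.1) p.2 /
          ((p.1.factorial : ℂ) * (p.2.factorial : ℂ))) := by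
    intro p hp
    rw [HasAntidiagonal.mem_antidiagonal] at hp
    have f1 : ((k + p.1).factorial : ℂ) ≠ 0 := Nat.cast_ne_zero.mpr (Nat.factorial_ne_zero _)
    have hc' : poch c (k + n) = poch c (k + p.1) * poch (c + k + p.1) p.2 := by
      rw [← hp, ← add_assoc, poch_add c (k + p.1) p.2]
      push_cast
      rw [add_assoc c]
    rw [hc'] at hc
    obtain ⟨hc1, hc2⟩ := mul_ne_zero_iff.mp hc
    rw [hc', poch_neg_nat_eq, poch_add a, poch_add b]
    field_simp
  rw [sum_congr rfl hL, ← mul_sum, ← hS, mul_sum, mul_sum]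
  refine sum_congr rfl fun p hp => ?_
  rw [HasAntidiagonal.mem_antidiagonal] at hp
  -- The denominators are known to be nonzero only up to index M = k + x; beyond that, (-x)_p = 0
  -- kills both terms.
  rcases lt_or_ge x p.1 with hlt | hge
  · rw [poch_neg_nat hlt]
    simp
  have hsplit : ∀ y : ℂ, poch y (k + n) =
      poch y k * poch (y + k) p.1 * poch (y + k + p.1) p.2 := by
    intro y
    rw [← hp, poch_add, poch_add]
    ring
  have hnz : ∀ y : ℂ, poch y (k + x) ≠ 0 → poch y k ≠ 0 ∧ poch (y + k) p.1 ≠ 0 := by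
    intro y hy
    rw [poch_add] at hy
    exact ⟨left_ne_zero_of_mul hy, poch_ne_zero_of_le hge (right_ne_zero_of_mul hy)⟩
  obtain ⟨a1, a2⟩ := hnz A h2
  obtain ⟨b1, b2⟩ := hnz B h3
  have f1 : ((k + n).factorial : ℂ) ≠ 0 := Nat.cast_ne_zero.mpr (Nat.factorial_ne_zero _)
  have f2 : (n.factorial : ℂ) ≠ 0 := Nat.cast_ne_zero.mpr (Nat.factorial_ne_zero _)
  have hq : poch (-(n : ℂ)) p.1 = (-1) ^ p.1 * (n.factorial : ℂ) / (p.2.factorial : ℂ) := by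
    have := poch_neg_nat_eq p.1 p.2
    rwa [hp] at this
  rw [hsplit A, hsplit B, poch_neg_nat_eq, hq]
  field_simp

/-- The coefficient form of the second Miller-Paris transformation. -/
theorem miller_paris_coeff {r : ℕ} {a b c lam : ℂ} {f : Fin r → ℂ} {m : Fin r → ℕ} {M N : ℕ}
    (hM : M = ∑ i, m i) (hlam : lam = c - a - b - M) (hc : poch c N ≠ 0)
    (h2 : poch (c - a - M) M ≠ 0) (h3 : poch (c - b - M) M ≠ 0) :
    ∑ p ∈ antidiagonal N, poch lam p.2 / (p.2.factorial : ℂ) *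
        (poch a p.1 * poch b p.1 / (poch c p.1 * (p.1.factorial : ℂ)) *
          ∑ k ∈ range (M + 1), poch (-(p.1 : ℂ)) k / (k.factorial : ℂ) *
            hypF (-(k : ℂ) ::ₘ shiftedParams f m) (vecParams f) 1) =
      poch (a + lam) N * poch (b + lam) N / (poch c N * (N.factorial : ℂ)) *
        (Qhat a b c f m).eval (-(N : ℂ)) := by
  have hQ : (Qhat a b c f m).eval (-(N : ℂ)) = ∑ k ∈ range (M + 1),
      hypF (-(k : ℂ) ::ₘ shiftedParams f m) (vecParams f) 1 / (k.factorial : ℂ) *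
        (poch a k * poch b k * poch (-(N : ℂ)) k / (poch (c - a - M) k * poch (c - b - M) k)) *
        ∑ l ∈ range (M - k + 1), poch (-(M : ℂ) + k) l * poch lam l /
          (poch (c - a - M + k) l * poch (c - b - M + k) l * (l.factorial : ℂ)) *
            poch (-(N : ℂ) + k) l := by
    unfold Qhat
    rw [hlam]
    subst hM
    simp only [Polynomial.eval_finsetSum, Polynomial.eval_mul, Polynomial.eval_C,
      Polynomial.eval_comp, Polynomial.eval_add, Polynomial.eval_X]
    refine sum_congr rfl fun k _ => ?_
    rw [show ∀ (t : ℂ) (l : ℕ), (ascPochhammer ℂ l).eval t = poch t l from fun _ _ => rfl]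
    simp only [show ∀ (t : ℂ) (l : ℕ), (ascPochhammer ℂ l).eval t = poch t l from fun _ _ => rfl]
    ring
  rw [hQ, mul_sum]
  have hswap : ∑ p ∈ antidiagonal N, poch lam p.2 / (p.2.factorial : ℂ) *
        (poch a p.1 * poch b p.1 / (poch c p.1 * (p.1.factorial : ℂ)) *
          ∑ k ∈ range (M + 1), poch (-(p.1 : ℂ)) k / (k.factorial : ℂ) *
            hypF (-(k : ℂ) ::ₘ shiftedParams f m) (vecParams f) 1) =
      ∑ k ∈ range (M + 1), hypF (-(k : ℂ) ::ₘ shiftedParams f m) (vecParams f) 1 /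
        (k.factorial : ℂ) * ∑ p ∈ antidiagonal N, poch lam p.2 / (p.2.factorial : ℂ) *
        (poch a p.1 * poch b p.1 / (poch c p.1 * (p.1.factorial : ℂ))) * poch (-(p.1 : ℂ)) k := by
    simp only [mul_sum]
    rw [sum_comm]
    refine sum_congr rfl fun k _ => sum_congr rfl fun p _ => ?_
    ring
  rw [hswap]
  refine sum_congr rfl fun k hk => ?_
  rw [miller_paris_term (Nat.lt_succ_iff.mp (mem_range.mp hk)) hlam hc h2 h3,
    show a + lam = c - b - M by rw [hlam]; ring, show b + lam = c - a - M by rw [hlam]; ring]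
  ring

/-! ### The ratio of the numerator and denominator parameters `f + m`, `f` -/

/-- Factoring (f)_{m+j} in two ways gives (f+m)_j / (f)_j = (f+j)_m / (f)_m, a polynomial in j of
degree m. -/
theorem pochVec_shifted_div {r : ℕ} {f : Fin r → ℂ} {m : Fin r → ℕ} {M : ℕ}
    (hM : M = ∑ i, m i) (hf : ∀ i, poch (f i) M ≠ 0) :
    ∃ Q : ℂ[X], Q.natDegree ≤ M ∧ ∀ j : ℕ, (∀ i, poch (f i) j ≠ 0) →
      pochVec (shiftedParams f m) j / pochVec (vecParams f) j = Q.eval (j : ℂ) := by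
  refine ⟨∏ i, (Polynomial.C (1 / poch (f i) (m i)) *
    (ascPochhammer ℂ (m i)).comp (Polynomial.X + Polynomial.C (f i))), ?_, fun j hj => ?_⟩
  · refine (Polynomial.natDegree_prod_le _ _).trans ?_
    rw [hM]
    refine sum_le_sum fun i _ => (Polynomial.natDegree_C_mul_le _ _).trans ?_
    rw [Polynomial.natDegree_comp, ascPochhammer_natDegree, Polynomial.natDegree_X_add_C, mul_one]
  · have e1 : pochVec (shiftedParams f m) j = ∏ i, poch (f i + m i) j := by
      simp only [pochVec, shiftedParams, Multiset.map_map]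
      rfl
    have e2 : pochVec (vecParams f) j = ∏ i, poch (f i) j := by
      simp only [pochVec, vecParams, Multiset.map_map]
      rfl
    rw [e1, e2, ← prod_div_distrib, Polynomial.eval_prod]
    refine prod_congr rfl fun i _ => ?_
    have hm : poch (f i) (m i) ≠ 0 := by
      refine poch_ne_zero_of_le ?_ (hf i)
      rw [hM]
      exact single_le_sum (f := m) (fun _ _ => Nat.zero_le _) (mem_univ i)
    rw [Polynomial.eval_mul, Polynomial.eval_C, Polynomial.eval_comp, Polynomial.eval_add,
      Polynomial.eval_X, Polynomial.eval_C,
      show (ascPochhammer ℂ (m i)).eval ((j : ℂ) + f i) = poch (f i + j) (m i) by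
        rw [add_comm]; rfl]
    have h1 := poch_add (f i) (m i) j
    rw [add_comm (m i) j, poch_add (f i) j (m i)] at h1
    have hj' := hj i
    field_simp
    linear_combination -h1

/-- A hypergeometric series with upper parameter `-n` is a sum over `0 ≤ k ≤ n`. -/
theorem hypF_terminating {U L : Multiset ℂ} (n : ℕ) :
    hypF (-(n : ℂ) ::ₘ U) L 1 = ∑ k ∈ range (n + 1),
      poch (-(n : ℂ)) k * pochVec U k / (pochVec L k * (k.factorial : ℂ)) := by
  unfold hypF
  rw [tsum_eq_sum (s := range (n + 1))]
  · refine sum_congr rfl fun k _ => ?_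
    simp [pochVec]
  · intro k hk
    rw [mem_range, not_lt] at hk
    simp [pochVec, poch_neg_nat hk]

/-- The Newton coefficients of this polynomial are binomial sums of its values at 0, …, k, which are
the terminating series in Q̂. -/
theorem pochVec_shifted_div_eq_sum {r : ℕ} {f : Fin r → ℂ} {m : Fin r → ℕ} {M : ℕ}
    (hM : M = ∑ i, m i) (hf : ∀ i, poch (f i) M ≠ 0) {j : ℕ} (hj : ∀ i, poch (f i) j ≠ 0) :
    pochVec (shiftedParams f m) j / pochVec (vecParams f) j =
      ∑ k ∈ range (M + 1), poch (-(j : ℂ)) k / (k.factorial : ℂ) *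
        hypF (-(k : ℂ) ::ₘ shiftedParams f m) (vecParams f) 1 := by
  obtain ⟨Q, hQ, hQj⟩ := pochVec_shifted_div hM hf
  rw [hQj j hj, newton_expansion Q hQ]
  refine sum_congr rfl fun k hk => ?_
  rw [hypF_terminating]
  congr 1
  refine sum_congr rfl fun i hi => ?_
  rw [mem_range] at hk hi
  rw [← hQj i fun s => poch_ne_zero_of_le (by omega) (hf s)]
  ring

/-! ### The parameters given by the roots of the characteristic polynomial -/

theorem pochVec_add_one_mul_prod (s : Multiset ℂ) (k : ℕ) :
    pochVec (s.map fun z => z + 1) k * s.prod = pochVec s k * (s.map fun z => z + (k : ℂ)).prod := by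
  induction s using Multiset.induction_on with
  | empty => simp [pochVec]
  | cons z s ih =>
    simp only [pochVec, Multiset.map_cons, Multiset.prod_cons] at ih ⊢
    have h := poch_succ_left z k
    rw [poch_succ] at h
    linear_combination (-((Multiset.map (fun a => poch a k)
      (Multiset.map (fun z => z + 1) s)).prod * s.prod)) * h + poch z k * (z + k) * ih

/-- Over ℂ, Q(t) is a constant times ∏(z - t), and Q(0) = 1 fixes the constant: Q(-k) = ∏(z + k)/z.
The degree of Q plays no role. -/
theorem pochVec_roots_add_one {Q : ℂ[X]} (hQ : Q.eval 0 = 1) (k : ℕ) :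
    pochVec (Q.roots.map fun z => z + 1) k = pochVec Q.roots k * Q.eval (-(k : ℂ)) := by
  have hev : ∀ t : ℂ, Q.eval t =
      Q.leadingCoeff * (-1) ^ Multiset.card Q.roots * (Q.roots.map fun z => z - t).prod := by
    intro t
    have hneg := Multiset.prod_map_neg (Q.roots.map fun z => z - t)
    rw [Multiset.map_map, Multiset.card_map] at hneg
    rw [(IsAlgClosed.splits Q).eval_eq_prod_roots, mul_assoc, ← hneg]
    simp
  have h := pochVec_add_one_mul_prod Q.roots k
  have h0 := hev 0
  have hk := hev (-(k : ℂ))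
  simp only [sub_zero, Multiset.map_id', sub_neg_eq_add] at h0 hk
  rw [hQ] at h0
  rw [hk]
  linear_combination (Q.leadingCoeff * (-1) ^ Multiset.card Q.roots) * h +
    pochVec (Q.roots.map fun z => z + 1) k * h0

/-! ### Summation of the dual series -/

theorem pochInt_natCast_succ_sub_one (x : ℂ) (n : ℕ) :
    pochInt x (((n + 1 : ℕ) : ℤ) - 1) = poch x n := by
  rw [show ((n + 1 : ℕ) : ℤ) - 1 = Int.ofNat n by push_cast; simp]
  rfl

theorem pochInt_zero_sub_one (x : ℂ) : pochInt x (((0 : ℕ) : ℤ) - 1) = 1 / (x - 1) := by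
  rw [show ((0 : ℕ) : ℤ) - 1 = Int.negSucc 0 by rfl]
  simp [pochInt, poch_one]

/-- The `k`-th coefficient `(-n)_k (d)_k (w+k) / (w (g)_k (e)_k)`. -/
noncomputable def shiftCoeff (n : ℕ) (d w g e : ℂ) (k : ℕ) : ℂ :=
  poch (-(n : ℂ)) k * poch d k * (w + k) / (w * poch g k * poch e k)

/-- Completing the denominators to (g)_n (e)_n and using (-n+j)_s = (-N)_s brings the sum to the
form of `saalschutz_with_unit_shift`. -/
theorem sum_shiftCoeff_eq {n j N : ℕ} {d w g e lam : ℂ} (hn : j + N = n)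
    (hg : poch g n ≠ 0) (he : poch e n ≠ 0) :
    ∑ s ∈ antidiagonal N, shiftCoeff n d w g e (j + s.1) * (poch lam s.1 / (s.1.factorial : ℂ)) =
      poch (-(n : ℂ)) j * poch d j / (w * poch g n * poch e n) *
        ∑ p ∈ antidiagonal N, (N.choose p.1 : ℂ) * ((-1) ^ p.1 * poch (d + j) p.1 *
          poch lam p.1 * (w + j + p.1) * poch (g + j + p.1) p.2 * poch (e + j + p.1) p.2) := by
  rw [mul_sum]
  refine sum_congr rfl fun p hp => ?_
  have hch := choose_div_factorial hp
  rw [HasAntidiagonal.mem_antidiagonal] at hp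
  subst hn
  have hsplit : ∀ y : ℂ, poch y (j + N) = poch y (j + p.1) * poch (y + j + p.1) p.2 := by
    intro y
    rw [← hp, ← add_assoc, poch_add]
    push_cast
    rw [add_assoc y]
  have hneg : poch (-((j + N : ℕ) : ℂ) + j) p.1 =
      (-1) ^ p.1 * (N.factorial : ℂ) / (p.2.factorial : ℂ) := by
    rw [← hp, ← poch_neg_nat_eq]
    congr 1
    push_cast
    ring
  have f1 : (N.factorial : ℂ) ≠ 0 := Nat.cast_ne_zero.mpr (Nat.factorial_ne_zero _)
  rw [div_eq_iff f1] at hch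
  rw [hsplit] at hg he
  obtain ⟨g1, g2⟩ := mul_ne_zero_iff.mp hg
  obtain ⟨e1, e2⟩ := mul_ne_zero_iff.mp he
  unfold shiftCoeff
  rw [hch, hsplit g, hsplit e, poch_add _ j, hneg, poch_add d]
  -- For w = 0 both sides are 0, by the convention x / 0 = 0.
  rcases eq_or_ne w 0 with rfl | hw
  · simp
  push_cast
  field_simp
  ring

/-- The factor `Ω` times the dual series is again a product of Pochhammer symbols. -/
theorem omega_mul_sum_shiftCoeff {n j N : ℕ} {d e g h lam mu : ℂ} (hn : j + N = n)
    (hmu : mu = muParam n d e g h lam) (hbal : g + e + n - d + lam = 2) (hh : h ≠ 0)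
    (hg : poch g n ≠ 0) (he : poch e n ≠ 0) (hgl : poch (g + lam) n ≠ 0)
    (hel : poch (e + lam) n ≠ 0) (hden : muDen n d g h lam ≠ 0) (hmu0 : mu ≠ 0) :
    OmegaFactor n d e g h lam * ∑ s ∈ antidiagonal N,
        shiftCoeff n d mu (g + lam) (e + lam) (j + s.1) * (poch lam s.1 / (s.1.factorial : ℂ)) =
      shiftCoeff n d h g e j := by
  have hnum : muNum n d e g h lam = mu * muDen n d g h lam := by
    rw [hmu, muParam, div_mul_cancel₀ _ hden]
  rw [sum_shiftCoeff_eq hn hgl hel]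
  have hd : d = g + e + n + lam - 2 := by linear_combination -hbal
  cases n with
  | zero =>
    obtain ⟨rfl, rfl⟩ : j = 0 ∧ N = 0 := by omega
    -- At n = 0 the index -1 in Ω puts g + λ - 1 and e + λ - 1 in denominators; μ ≠ 0 keeps them
    -- nonzero.
    have hnum0 : h * (g + lam - 1) * (e + lam - 1) ≠ 0 := by
      have : muNum (0 : ℕ) d e g h lam ≠ 0 := by rw [hnum]; exact mul_ne_zero hmu0 hden
      simpa [muNum] using this
    have h1 : g + lam - 1 ≠ 0 := fun h0 => hnum0 (by rw [h0]; ring)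
    have h2 : e + lam - 1 ≠ 0 := fun h0 => hnum0 (by rw [h0]; ring)
    simp only [OmegaFactor, pochInt_zero_sub_one, shiftCoeff, muNum, poch_zero]
    simp [poch_zero]
    field_simp
  | succ n =>
    simp only [OmegaFactor, pochInt_natCast_succ_sub_one, shiftCoeff]
    rw [hnum]
    rw [poch_succ] at hgl hel
    obtain ⟨gl1, gl2⟩ := mul_ne_zero_iff.mp hgl
    obtain ⟨el1, el2⟩ := mul_ne_zero_iff.mp hel
    rw [poch_succ (g + lam), poch_succ (e + lam)]
    cases N with
    | zero =>
      obtain rfl : j = n + 1 := by omega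
      have key : mu * muDen (n + 1 : ℕ) d g h lam + (n + 1 : ℕ) * muDen (n + 1 : ℕ) d g h lam =
          (h + (n + 1 : ℕ)) * (g + lam + n) * (e + lam + n) := by
        rw [← hnum, muNum, muDen, hd]
        push_cast
        ring
      simp only [Nat.antidiagonal_zero, sum_singleton, poch_zero, Nat.choose_self, Nat.cast_one,
        pow_zero, one_mul, mul_one, Nat.cast_zero, add_zero]
      generalize poch (-((n + 1 : ℕ) : ℂ)) (n + 1) * poch d (n + 1) = K
      push_cast at key ⊢
      generalize muDen (n + 1) d g h lam = m at *
      field_simp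
      linear_combination K * key
    | succ N =>
      obtain rfl : n = j + N := by omega
      push_cast at hd
      rw [saalschutz_with_unit_shift (d + j) lam (mu + j) (g + lam + j) (e + lam + j) N
        (by rw [hd]; push_cast; ring), show g + lam + j - lam = g + j by ring,
        show e + lam + j - lam = e + j by ring]
      have hsplit : ∀ y : ℂ, poch y (j + N + 1) = poch y j * poch (y + j) N * (y + j + N) := by
        intro y
        rw [poch_succ, poch_add]
        push_cast
        ring
      rw [hsplit] at hg he
      have g1 : poch g j ≠ 0 := fun h0 => hg (by rw [h0]; ring)
      have g2 : poch (g + j) N ≠ 0 := fun h0 => hg (by rw [h0]; ring)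
      have g3 : g + j + N ≠ 0 := fun h0 => hg (by rw [h0]; ring)
      have e1 : poch e j ≠ 0 := fun h0 => he (by rw [h0]; ring)
      have e2 : poch (e + j) N ≠ 0 := fun h0 => he (by rw [h0]; ring)
      have e3 : e + j + N ≠ 0 := fun h0 => he (by rw [h0]; ring)
      rw [hsplit g, hsplit e]
      -- Here the formula for μ enters: multiplied by its denominator, the bracket from the ₄F₃ sum
      -- factors, and for fixed j + N it depends on j only through h + j.
      have key : muDen (j + N + 1 : ℕ) d g h lam *
          ((N + 1) * (d + j) * (mu + j - lam) + (mu + j) * (g + j - 1) * (e + j - 1)) =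
          (h + j) * (g + lam + (j + N : ℕ)) * (e + lam + (j + N : ℕ)) *
            (g + j + N) * (e + j + N) := by
        have h1 : muDen (j + N + 1 : ℕ) d g h lam *
          ((N + 1) * (d + j) * (mu + j - lam) + (mu + j) * (g + j - 1) * (e + j - 1)) =
          mu * muDen (j + N + 1 : ℕ) d g h lam *
            ((N + 1) * (d + j) + (g + j - 1) * (e + j - 1)) +
          muDen (j + N + 1 : ℕ) d g h lam *
            ((N + 1) * (d + j) * (j - lam) + j * (g + j - 1) * (e + j - 1)) := by ring
        rw [h1, ← hnum, muNum, muDen, hd]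
        push_cast
        ring
      generalize poch (-((j + N + 1 : ℕ) : ℂ)) j * poch d j = K
      generalize muDen (j + N + 1 : ℕ) d g h lam = m at *
      push_cast at key gl2 el2 ⊢
      clear hmu hbal hd hnum hgl hel hg he hsplit
      rw [div_mul_eq_mul_div, div_mul_eq_mul_div K, mul_div_assoc', div_mul_eq_mul_div, div_div,
        div_eq_div_iff
        (by simp only [ne_eq, mul_eq_zero, not_or]; tauto)
        (by simp only [ne_eq, mul_eq_zero, not_or]; tauto)]
      linear_combination (poch (g + lam) (j + N) * poch (e + lam) (j + N) * mu * K *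
        poch (g + j) N * poch (e + j) N * h * poch g j * poch e j) * key

/-! ### Series in terms of `shiftCoeff` -/

theorem pochVec_add (A B : Multiset ℂ) (k : ℕ) : pochVec (A + B) k = pochVec A k * pochVec B k := by
  simp [pochVec]

theorem poch_add_one_div {w : ℂ} {k : ℕ} (hw : w ≠ 0) (hk : poch w k ≠ 0) :
    poch (w + 1) k / poch w k = (w + k) / w := by
  have h := poch_succ_left w k
  rw [poch_succ] at h
  field_simp
  linear_combination -h

/-- Gives both series one shape, with w = h on the left and w = μ on the right. -/
theorem hypF_eq_sum_shiftCoeff {n : ℕ} {a b c d g e w : ℂ} {U L : Multiset ℂ} (hw : w ≠ 0)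
    (hwn : poch w n ≠ 0) :
    hypF ({-(n : ℂ), a, b, d, w + 1} + U) ({c, g, e, w} + L) 1 =
      ∑ p ∈ antidiagonal n, shiftCoeff n d w g e p.1 *
        (poch a p.1 * poch b p.1 / (poch c p.1 * (p.1.factorial : ℂ)) *
          (pochVec U p.1 / pochVec L p.1)) := by
  have h : ({-(n : ℂ), a, b, d, w + 1} + U : Multiset ℂ) =
      -(n : ℂ) ::ₘ ({a, b, d, w + 1} + U) := by
    rw [Multiset.insert_eq_cons, Multiset.cons_add]
  rw [h, hypF_terminating, Nat.sum_antidiagonal_eq_sum_range_succ_mk]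
  refine sum_congr rfl fun k hk => ?_
  have hk' := poch_add_one_div hw
    (poch_ne_zero_of_le (Nat.lt_succ_iff.mp (mem_range.mp hk)) hwn)
  rw [pochVec_add, pochVec_add]
  have e1 : pochVec {a, b, d, w + 1} k = poch a k * poch b k * poch d k * poch (w + 1) k := by
    simp [pochVec, mul_assoc]
  have e2 : pochVec {c, g, e, w} k = poch c k * poch g k * poch e k * poch w k := by
    simp [pochVec, mul_assoc]
  rw [e1, e2, shiftCoeff, mul_div_assoc (poch (-(n : ℂ)) k * poch d k) (w + k),
    show (w + k) / (w * poch g k * poch e k) =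
      (poch (w + 1) k / poch w k) / (poch g k * poch e k) by
        rw [hk', div_div, mul_assoc]]
  ring

theorem pochVec_ne_zero {A : Multiset ℂ} {k n : ℕ} (hk : k ≤ n) (h : ∀ x ∈ A, poch x n ≠ 0) :
    pochVec A k ≠ 0 := by
  refine Multiset.prod_ne_zero fun h0 => ?_
  obtain ⟨x, hx, hx0⟩ := Multiset.mem_map.mp h0
  exact poch_ne_zero_of_le hk (h x hx) hx0

theorem sum_shiftedParams {r : ℕ} (f : Fin r → ℂ) (m : Fin r → ℕ) :
    (shiftedParams f m).sum = (vecParams f).sum + ((∑ i, m i : ℕ) : ℂ) := by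
  simp only [shiftedParams, vecParams, Multiset.sum_map_add]
  push_cast
  rfl

/-! ### The transformation and the Saalschützian property -/

theorem theorem3 {r : ℕ} (n : ℕ) (a b c d e g h lam mu : ℂ) (f : Fin r → ℂ) (m : Fin r → ℕ)
    (M : ℕ) (zeta : Multiset ℂ)
    -- `M` is the total shift `m_1 + ⋯ + m_r`
    (hM : M = ∑ i, m i)
    (hlam : lam = c - a - b - M)
    (hmu : mu = muParam n d e g h lam)
    -- the roots of the characteristic polynomial, with multiplicities
    (hzeta : zeta = (Qhat a b c f m).roots)
    (h1 : poch (1 + a + b - c) M ≠ 0)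
    (h2 : poch (c - a - M) M ≠ 0)
    (h3 : poch (c - b - M) M ≠ 0)
    (hbal : g + e + n - d + lam = 2)
    -- no denominator vanishes in the terms of the terminating series, in the coefficients of the
    -- characteristic polynomial, or in the definition of `mu`
    (hL : ∀ x ∈ lhsLower c g e h f, poch x n ≠ 0)
    (hR : ∀ x ∈ rhsLower c g e lam mu zeta, poch x n ≠ 0)
    (hf : ∀ i, poch (f i) M ≠ 0)
    (hden : muDen n d g h lam ≠ 0)
    (hmu0 : mu ≠ 0) :
    hypF (lhsUpper n a b d h f m) (lhsLower c g e h f) 1 =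
        OmegaFactor n d e g h lam *
          hypF (rhsUpper n a b d lam mu zeta) (rhsLower c g e lam mu zeta) 1 ∧
      IsSaalschutzian (lhsUpper n a b d h f m) (lhsLower c g e h f) ∧
      (Multiset.card zeta = M →
        IsSaalschutzian (rhsUpper n a b d lam mu zeta) (rhsLower c g e lam mu zeta)) := by
  refine ⟨?_, ⟨?_, ⟨n, by simp [lhsUpper]⟩, ?_⟩, fun hcard => ⟨?_, ⟨n, by simp [rhsUpper]⟩, ?_⟩⟩
  · have hc : poch c n ≠ 0 := hL c (by simp [lhsLower])
    have hg : poch g n ≠ 0 := hL g (by simp [lhsLower])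
    have he : poch e n ≠ 0 := hL e (by simp [lhsLower])
    have hhn : poch h n ≠ 0 := hL h (by simp [lhsLower])
    have hfn : ∀ i, poch (f i) n ≠ 0 := fun i => hL (f i) (by simp [lhsLower, vecParams])
    have hgl : poch (g + lam) n ≠ 0 := hR _ (by simp [rhsLower])
    have hel : poch (e + lam) n ≠ 0 := hR _ (by simp [rhsLower])
    have hmun : poch mu n ≠ 0 := hR _ (by simp [rhsLower])
    have hzn : ∀ z ∈ zeta, poch z n ≠ 0 := fun z hz => hR z (by simp [rhsLower, hz])
    -- For n ≥ 1 this follows from (h)_n ≠ 0; for n = 0 that is vacuous, but then h divides the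
    -- numerator of μ.
    have hh : h ≠ 0 := by
      rintro rfl
      cases n with
      | zero => exact hmu0 (by simp [hmu, muParam, muNum])
      | succ n => exact hhn (by rw [poch_succ_left, zero_mul])
    -- The coefficient identity at N = 0 is exactly this normalization.
    have hQ0 : (Qhat a b c f m).eval 0 = 1 := by
      have h0 := miller_paris_coeff (f := f) (N := 0) hM hlam (by simp [poch_zero]) h2 h3
      simp only [Nat.antidiagonal_zero, sum_singleton] at h0
      rw [← pochVec_shifted_div_eq_sum hM hf (by simp [poch_zero])] at h0
      simpa [poch_zero, pochVec] using h0.symm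
    have hrhs : rhsLower c g e lam mu zeta = {c, g + lam, e + lam, mu} + zeta := by
      unfold rhsLower
      congr 1
      simp only [Multiset.insert_eq_cons]
      rw [Multiset.cons_swap (e + lam) c, Multiset.cons_swap (g + lam) c]
    have hrhs' : rhsUpper n a b d lam mu zeta =
        {-(n : ℂ), a + lam, b + lam, d, mu + 1} + zeta.map fun z => z + 1 := by
      unfold rhsUpper
      congr 1
      simp only [Multiset.insert_eq_cons]
      rw [Multiset.cons_swap d (a + lam), Multiset.cons_swap d (b + lam)]
    rw [hrhs, hrhs', lhsUpper, lhsLower, hypF_eq_sum_shiftCoeff hh hhn,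
      hypF_eq_sum_shiftCoeff hmu0 hmun]
    set A : ℕ → ℂ := fun j => poch a j * poch b j / (poch c j * (j.factorial : ℂ)) *
          (pochVec (shiftedParams f m) j / pochVec (vecParams f) j) with hA
    have hR' : ∀ p ∈ antidiagonal n, shiftCoeff n d mu (g + lam) (e + lam) p.1 *
        (poch (a + lam) p.1 * poch (b + lam) p.1 / (poch c p.1 * (p.1.factorial : ℂ)) *
          (pochVec (zeta.map fun z => z + 1) p.1 / pochVec zeta p.1)) =
        ∑ s ∈ antidiagonal p.1, shiftCoeff n d mu (g + lam) (e + lam) (s.1 + s.2) *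
          (poch lam s.2 / (s.2.factorial : ℂ)) * A s.1 := by
      intro p hp
      rw [HasAntidiagonal.mem_antidiagonal] at hp
      have hle : p.1 ≤ n := by omega
      have hz : pochVec (zeta.map fun z => z + 1) p.1 / pochVec zeta p.1 =
          (Qhat a b c f m).eval (-(p.1 : ℂ)) := by
        rw [div_eq_iff (pochVec_ne_zero hle hzn), hzeta, pochVec_roots_add_one hQ0, mul_comm]
      rw [hz, ← miller_paris_coeff hM hlam (poch_ne_zero_of_le hle hc) h2 h3, mul_sum]
      refine sum_congr rfl fun s hs => ?_
      rw [HasAntidiagonal.mem_antidiagonal] at hs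
      rw [← pochVec_shifted_div_eq_sum hM hf
        fun i => poch_ne_zero_of_le (by omega : s.1 ≤ n) (hfn i), hs]
      ring
    rw [sum_congr rfl hR', sum_antidiagonal_assoc n fun i j _ =>
      shiftCoeff n d mu (g + lam) (e + lam) (i + j) * (poch lam j / (j.factorial : ℂ)) * A i,
      mul_sum]
    refine sum_congr rfl fun p hp => ?_
    rw [HasAntidiagonal.mem_antidiagonal] at hp
    rw [← omega_mul_sum_shiftCoeff hp hmu hbal hh hg he hgl hel hden hmu0, ← sum_mul]
    ring
  · simp [lhsUpper, lhsLower, shiftedParams, vecParams]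
  · rw [parametricExcess, lhsUpper, lhsLower, Multiset.sum_add, Multiset.sum_add,
      sum_shiftedParams, ← hM]
    simp only [Multiset.insert_eq_cons, Multiset.sum_cons, Multiset.sum_singleton]
    linear_combination hbal - hlam
  · simp [rhsUpper, rhsLower]
  · rw [parametricExcess, rhsUpper, rhsLower, Multiset.sum_add, Multiset.sum_add,
      Multiset.sum_map_add]
    -- Each of the M roots contributes 1 to the upper sum, matching the M in λ; this is where full
    -- degree matters.
    simp only [Multiset.insert_eq_cons, Multiset.sum_cons, Multiset.sum_singleton,
      Multiset.map_id', Multiset.map_const', Multiset.sum_replicate, hcard, nsmul_eq_mul]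
    linear_combination hbal - hlam
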